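/- All graphs are finite, undirected and simple. For a connected graph $G$ with vertex set $V$ and edge set $E$, let $d(u,v)$ be the distance between $u$ and $v$, and let $$W(G)=\sum_{\{u,v\}\subseteq V} d(u,v)$$ be its Wiener index. For an edge $e=uv$ let $n_u(e)=|\{w\in V: d(u,w)<d(v,w)\}|$, $n_v(e)=|\{w\in V: d(v,w)<d(u,w)\}|$ and $n_0(e)=|\{w\in V: d(u,w)=d(v,w)\}|$, and let $$Sz^*(G)=\sum_{e=uv\in E}\left(n_u(e)+\frac{n_0(e)}{2}\right)\left(n_v(e)+\frac{n_0(e)}{2}\right)$$ be the revised Szeged index of $G$. Let $G$ be a connected bipartite graph with $n\ge 4$ vertices and $m\ge n$ edges. Then $$Sz^*(G)-W(G)\ \ge\ 4n-8.$$ Moreover, the bound is best possible for every $n\ge 4$: trees on $n-3$ vertices exist, and for every tree $T$ on $n-3$ vertices and every vertex $w$ of $T$, the graph composed of a 4-cycle $C_4$ and $T$ sharing the single vertex $w$ is a connected bipartite graph with $n$ vertices and at least $n$ edges, for which equality holds. -/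

import Mathlib

namespace SimpleGraph

variable {V : Type*}

/-- `n_u(e)` for the edge `e = uv`: the number of vertices strictly closer to `u` than to `v`. -/
noncomputable def numCloser [Fintype V] (G : SimpleGraph V) (u v : V) : ℕ :=
  {w : V | G.dist u w < G.dist v w}.ncard

/-- `n_0(e)` for the edge `e = uv`: the number of vertices at equal distance from `u` and `v`. -/
noncomputable def numEquidistant [Fintype V] (G : SimpleGraph V) (u v : V) : ℕ :=
  {w : V | G.dist u w = G.dist v w}.ncard

theorem numEquidistant_comm [Fintype V] (G : SimpleGraph V) (u v : V) :
    G.numEquidistant u v = G.numEquidistant v u := by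
  unfold numEquidistant
  simp only [eq_comm]

open scoped Classical in
/-- The Wiener index `W(G)`: the sum of `d(u, v)` over all unordered pairs of vertices
(a pair on the diagonal of `Sym2 V` contributes `d(u, u) = 0`). -/
noncomputable def wienerIndex [Fintype V] (G : SimpleGraph V) : ℝ :=
  ∑ p : Sym2 V, Sym2.lift ⟨fun u v => (G.dist u v : ℝ), fun u v => by simp only [G.dist_comm]⟩ p

open scoped Classical in
/-- The revised Szeged index `Sz*(G)`: the sum over all edges `e = uv` of
`(n_u(e) + n_0(e)/2) * (n_v(e) + n_0(e)/2)`. -/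
noncomputable def revisedSzegedIndex [Fintype V] (G : SimpleGraph V) : ℝ :=
  ∑ e ∈ G.edgeFinset, Sym2.lift
    ⟨fun u v => ((G.numCloser u v : ℝ) + (G.numEquidistant u v : ℝ) / 2) *
        ((G.numCloser v u : ℝ) + (G.numEquidistant u v : ℝ) / 2),
      fun u v => by
        simp only [G.numEquidistant_comm u v]
        exact mul_comm _ _⟩ e

/-- The graph composed of `A` and `B` sharing a single vertex: the vertex `b` of `B` is identified
with the vertex `a` of `A`. Its vertices are those of `A` together with those of `B` other
than `b`. -/
def vertexGlue {α β : Type*} (A : SimpleGraph α) (a : α) (B : SimpleGraph β) (b : β) :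
    SimpleGraph (α ⊕ {y : β // y ≠ b}) where
  Adj
    | .inl x, .inl y => A.Adj x y
    | .inr x, .inr y => B.Adj x y
    | .inl x, .inr y => x = a ∧ B.Adj b y
    | .inr x, .inl y => y = a ∧ B.Adj x b
  symm := ⟨by
    rintro (x | x) (y | y) h
    · exact SimpleGraph.Adj.symm h
    · exact ⟨h.1, SimpleGraph.Adj.symm h.2⟩
    · exact ⟨h.1, SimpleGraph.Adj.symm h.2⟩
    · exact SimpleGraph.Adj.symm h⟩
  loopless := ⟨by
    rintro (x | x) h
    · exact A.irrefl h
    · exact B.irrefl h⟩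

/-- A 4-cycle and the graph `T` sharing the single vertex `w` of `T`. -/
def c4WithTree {α : Type*} (T : SimpleGraph α) (w : α) :
    SimpleGraph (α ⊕ {y : Fin 4 // y ≠ 0}) :=
  vertexGlue T w (cycleGraph 4) 0

end SimpleGraph

/-! In a connected bipartite graph no vertex is equidistant from the ends of an edge, so double
counting turns `2 (Sz* - W)` into the sum, over ordered pairs `(x, y)`, of the *excess*: the number
of oriented edges separating `x` from `y`, minus `d(x, y)`. The excess is nonnegative, since each
edge of a geodesic separates its ends.

*Lower bound.* A graph with at least as many edges as vertices has a cycle, and a shortest one is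
isometric (`Walk.IsCycle.dist_getVert`); here it has even length `2k ≥ 4`. Fix a vertex `z`, at
distance `h` from the cycle. A geodesic from `z` to a vertex `c` of the cycle has `h` edges within
the ball of radius `h` around `z`, and these separate `z` from `c` in addition to the separating
edges of the cycle. Each edge of the cycle separates `z` from exactly one of two antipodal vertices
`c`, `c'`, and `d(z, c) + d(z, c') ≤ 2h + k`; hence their excesses add up to at least
`2k + 2h - (2h + k) = k` (`IsIsometricEvenCycle.le_excess_add_excess`). Summing over the `k`
antipodal pairs, every vertex has total excess at least `k²` with the cycle, and therefore
`Sz* - W ≥ (n - 2k) k² + k³ ≥ 4n - 8`.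

*Sharpness.* In two graphs glued at a vertex, distances, separating edges and hence excesses are the
sums of those of the retractions onto the two parts (`excess_vertexGlue`). All excesses in a tree
vanish, because its edges are bridges (`excess_eq_zero_of_isTree`), and in a 4-cycle the excess
equals the distance. For a tree on `n - 3` vertices with a 4-cycle the sum is `8n - 16`. In
particular it is not zero, so the glued graph is not a tree and has at least `n` edges. -/

namespace SimpleGraph

/-! ### Separating edges and excess -/

open scoped Classical in
/-- The map `(u, v) ↦ s(u, v)` is two-to-one off the diagonal. -/
theorem two_mul_sum_sym2 {V : Type*} [Fintype V] (S : Finset (Sym2 V))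
    (hS : ∀ e ∈ S, ¬ e.IsDiag) (f : V → V → ℝ) (hf : ∀ u v, f u v = f v u) :
    2 * ∑ e ∈ S, Sym2.lift ⟨f, hf⟩ e = ∑ p : V × V, if s(p.1, p.2) ∈ S then f p.1 p.2 else 0 := by
  rw [← Finset.sum_filter, Finset.mul_sum,
    ← Finset.sum_fiberwise_of_maps_to (t := S) (g := fun p : V × V => s(p.1, p.2)) (by simp)]
  refine Finset.sum_congr rfl fun e he => ?_
  induction e with | h a b =>
  have hab : a ≠ b := by simpa using hS _ he
  have : (Finset.univ.filter fun p : V × V => s(p.1, p.2) ∈ S).filter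
      (fun p => s(p.1, p.2) = s(a, b)) = {(a, b), (b, a)} := by
    ext ⟨x, y⟩
    simp only [Finset.mem_filter, Finset.mem_univ, true_and, Finset.mem_insert,
      Finset.mem_singleton, Sym2.eq_iff, Prod.mk.injEq]
    refine ⟨fun h => h.2, fun h => ⟨?_, h⟩⟩
    rcases h with ⟨rfl, rfl⟩ | ⟨rfl, rfl⟩
    · exact he
    · rwa [Sym2.eq_swap]
  rw [this, Finset.sum_pair (by simp [hab])]
  simp only [Sym2.lift_mk]
  rw [hf b a]; ring

section Excess

variable {V : Type*} [Fintype V]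

open scoped Classical in
theorem two_mul_wienerIndex (G : SimpleGraph V) :
    2 * G.wienerIndex = ∑ p : V × V, (G.dist p.1 p.2 : ℝ) := by
  have hdiag : G.wienerIndex = ∑ e ∈ Finset.univ.filter (fun e : Sym2 V => ¬ e.IsDiag),
      Sym2.lift ⟨fun u v => (G.dist u v : ℝ), fun u v => by simp only [G.dist_comm]⟩ e := by
    unfold wienerIndex
    refine (Finset.sum_subset (Finset.filter_subset _ _) ?_).symm
    intro e _ he
    induction e with | h a b =>
    have : a = b := by simpa using he
    simp [this]
  rw [hdiag, two_mul_sum_sym2 _ (by simp)]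
  refine Finset.sum_congr rfl fun p _ => ?_
  by_cases h : p.1 = p.2 <;> simp [h]

open scoped Classical in
/-- The oriented edges `(u, v)` of `G` that separate `x` from `y`: those with `x` strictly closer
to `u` and `y` strictly closer to `v`. -/
noncomputable def separatingDarts (G : SimpleGraph V) (x y : V) : Finset (V × V) :=
  Finset.univ.filter fun p =>
    G.Adj p.1 p.2 ∧ G.dist p.1 x < G.dist p.2 x ∧ G.dist p.2 y < G.dist p.1 y

theorem mem_separatingDarts {G : SimpleGraph V} {x y : V} {p : V × V} :
    p ∈ G.separatingDarts x y ↔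
      G.Adj p.1 p.2 ∧ G.dist p.1 x < G.dist p.2 x ∧ G.dist p.2 y < G.dist p.1 y := by
  simp [separatingDarts]

theorem IsBipartite.dist_ne_of_adj {V : Type*} {G : SimpleGraph V} (hb : G.IsBipartite)
    (hG : G.Connected) {u v : V} (h : G.Adj u v) (w : V) : G.dist u w ≠ G.dist v w := by
  obtain ⟨c⟩ := hb
  let c' : G.Coloring Bool := G.recolorOfEquiv finTwoEquiv c
  obtain ⟨p, hp⟩ := hG.exists_walk_length_eq_dist u w
  obtain ⟨q, hq⟩ := hG.exists_walk_length_eq_dist v w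
  intro he
  have h1 := c'.even_length_iff_congr p
  have h2 := c'.even_length_iff_congr q
  have h3 := c'.valid h
  rw [hp] at h1
  rw [hq, ← he] at h2
  revert h1 h2 h3
  cases c' u <;> cases c' v <;> cases c' w <;> simp

theorem numEquidistant_eq_zero {G : SimpleGraph V} (hb : G.IsBipartite) (hG : G.Connected)
    {u v : V} (h : G.Adj u v) : G.numEquidistant u v = 0 := by
  simp [numEquidistant, hb.dist_ne_of_adj hG h]

open scoped Classical in
theorem numCloser_eq_card (G : SimpleGraph V) (u v : V) :
    G.numCloser u v = (Finset.univ.filter fun w => G.dist u w < G.dist v w).card := by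
  rw [numCloser, ← Set.ncard_coe_finset]
  simp

/-- Double counting of the triples formed by an oriented edge and a pair of vertices that it
separates; in a bipartite graph no vertex is equidistant from the ends of an edge. -/
theorem two_mul_revisedSzegedIndex {G : SimpleGraph V} (hb : G.IsBipartite) (hG : G.Connected) :
    2 * G.revisedSzegedIndex = ∑ p : V × V, ((G.separatingDarts p.1 p.2).card : ℝ) := by
  classical
  have h1 : 2 * G.revisedSzegedIndex = ∑ q : V × V, ∑ p : V × V,
      if q ∈ G.separatingDarts p.1 p.2 then (1 : ℝ) else 0 := by
    unfold revisedSzegedIndex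
    rw [two_mul_sum_sym2 _ (fun e he => G.not_isDiag_of_mem_edgeFinset (by convert he))]
    refine Finset.sum_congr rfl fun q _ => ?_
    by_cases h : G.Adj q.1 q.2
    · have h0 := numEquidistant_eq_zero hb hG h
      simp only [mem_edgeFinset, mem_edgeSet, h, if_true, h0, mem_separatingDarts, true_and]
      rw [← Finset.sum_filter, Finset.sum_const, nsmul_eq_mul, mul_one]
      simp only [Nat.cast_zero, zero_div, add_zero]
      rw [numCloser_eq_card, numCloser_eq_card, ← Nat.cast_mul, ← Finset.card_product]
      congr 2
      ext ⟨x, y⟩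
      simp
    · simp [h, mem_separatingDarts]
  rw [h1, Finset.sum_comm]
  simp

/-- The number of oriented edges separating `x` from `y` in excess of the distance of `x` and
`y`. -/
noncomputable def excess (G : SimpleGraph V) (x y : V) : ℤ :=
  (G.separatingDarts x y).card - G.dist x y

theorem two_mul_revisedSzegedIndex_sub_wienerIndex {G : SimpleGraph V} (hb : G.IsBipartite)
    (hG : G.Connected) :
    2 * (G.revisedSzegedIndex - G.wienerIndex) = ((∑ p : V × V, G.excess p.1 p.2 : ℤ) : ℝ) := by
  rw [mul_sub, two_mul_revisedSzegedIndex hb hG, two_mul_wienerIndex, ← Finset.sum_sub_distrib]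
  simp [excess]

theorem excess_comm (G : SimpleGraph V) (x y : V) : G.excess x y = G.excess y x := by
  unfold excess
  rw [G.dist_comm]
  congr 2
  refine Finset.card_bij' (fun p _ => p.swap) (fun p _ => p.swap) ?_ ?_ (by simp) (by simp)
  · simp only [mem_separatingDarts]
    exact fun p h => ⟨h.1.symm, h.2.2, h.2.1⟩
  · simp only [mem_separatingDarts]
    exact fun p h => ⟨h.1.symm, h.2.2, h.2.1⟩

/-- A geodesic from `x` to `y` supplies, for each `i < d(x, y)`, a separating oriented edge which
leaves the sphere of radius `i` around `x`. -/
theorem exists_mem_separatingDarts {G : SimpleGraph V} (hG : G.Connected) (x y : V) {i : ℕ}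
    (hi : i < G.dist x y) : ∃ p ∈ G.separatingDarts x y, G.dist p.1 x = i := by
  obtain ⟨p, hp⟩ := hG.exists_walk_length_eq_dist x y
  have key : ∀ j ≤ p.length,
      G.dist (p.getVert j) x = j ∧ G.dist (p.getVert j) y = p.length - j := by
    intro j hj
    have h1 := dist_le (p.take j)
    have h2 := dist_le (p.drop j)
    have h3 := hG.dist_triangle (u := x) (v := p.getVert j) (w := y)
    rw [Walk.take_length] at h1
    rw [Walk.drop_length] at h2
    rw [G.dist_comm (u := p.getVert j) (v := x)]
    omega
  have h1 := key i (by omega)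
  have h2 := key (i + 1) (by omega)
  refine ⟨(p.getVert i, p.getVert (i + 1)), ?_, h1.1⟩
  simp only [mem_separatingDarts]
  exact ⟨p.adj_getVert_succ (by omega), by omega, by omega⟩

/-- The separating oriented edges inside the ball of radius `h ≤ d(x, y)` number at least `h`, so
those of a family `D` outside this ball come in addition. -/
theorem add_card_le_card_separatingDarts {G : SimpleGraph V} (hG : G.Connected) (x y : V) (h : ℕ)
    (hh : h ≤ G.dist x y) (D : Finset (V × V)) (hD : D ⊆ G.separatingDarts x y)
    (hD' : ∀ p ∈ D, h ≤ G.dist p.1 x) : h + D.card ≤ (G.separatingDarts x y).card := by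
  classical
  have h1 : h ≤ ((G.separatingDarts x y).filter fun p => G.dist p.1 x < h).card := by
    have : Finset.range h ⊆
        ((G.separatingDarts x y).filter fun p => G.dist p.1 x < h).image fun p => G.dist p.1 x := by
      intro i hi
      rw [Finset.mem_range] at hi
      obtain ⟨p, hp, rfl⟩ := exists_mem_separatingDarts hG x y (hi.trans_le hh)
      exact Finset.mem_image.2 ⟨p, Finset.mem_filter.2 ⟨hp, hi⟩, rfl⟩
    simpa using (Finset.card_le_card this).trans Finset.card_image_le
  refine (Nat.add_le_add_right h1 _).trans ?_
  rw [← Finset.card_union_of_disjoint]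
  · exact Finset.card_le_card (Finset.union_subset (Finset.filter_subset _ _) hD)
  · rw [Finset.disjoint_left]
    intro p hp hpD
    have := hD' p hpD
    have := (Finset.mem_filter.1 hp).2
    omega

theorem excess_nonneg {G : SimpleGraph V} (hG : G.Connected) (x y : V) : 0 ≤ G.excess x y := by
  have := add_card_le_card_separatingDarts hG x y _ le_rfl ∅ (by simp) (by simp)
  simp only [Finset.card_empty, add_zero] at this
  unfold excess
  omega

end Excess

/-! ### Shortest cycles are isometric -/

section Girth

variable {V : Type*} {G : SimpleGraph V}

/-- Two distinct paths with the same ends contain a cycle, so the girth is at most the sum of their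
lengths. -/
theorem girth_le_length_add_length {x y : V} {p q : G.Walk x y} (hp : p.IsPath) (hq : q.IsPath)
    (hpq : p ≠ q) : G.girth ≤ p.length + q.length := by
  classical
  let H : SimpleGraph V := fromEdgeSet {e | e ∈ p.edges ++ q.edges}
  have hHE : ∀ e, e ∈ H.edgeSet → e ∈ p.edges ++ q.edges := by
    intro e he
    simp only [H, edgeSet_fromEdgeSet] at he
    exact he.1
  have hE : ∀ e ∈ p.edges ++ q.edges, e ∈ G.edgeSet := by
    intro e he
    rcases List.mem_append.1 he with he | he
    · exact p.edges_subset_edgeSet he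
    · exact q.edges_subset_edgeSet he
  have hEH : ∀ e ∈ p.edges ++ q.edges, e ∈ H.edgeSet := by
    intro e he
    simp only [H, edgeSet_fromEdgeSet]
    exact ⟨he, G.not_isDiag_of_mem_edgeSet (hE e he)⟩
  have hHG : H ≤ G := by
    rw [← edgeSet_subset_edgeSet]
    exact fun e he => hE e (hHE e he)
  have hpH : ∀ e ∈ p.edges, e ∈ H.edgeSet := fun e he => hEH e (List.mem_append_left _ he)
  have hqH : ∀ e ∈ q.edges, e ∈ H.edgeSet := fun e he => hEH e (List.mem_append_right _ he)
  have hcyc : ¬ H.IsAcyclic := by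
    intro hac
    apply hpq
    have := (hac.subsingleton_path x y).elim ⟨p.transfer H hpH, hp.transfer hpH⟩
      ⟨q.transfer H hqH, hq.transfer hqH⟩
    have h2 := congrArg (fun w : H.Path x y => w.1.mapLe hHG) this
    have h3 : ∀ (w : G.Walk x y) (hw : ∀ e ∈ w.edges, e ∈ H.edgeSet),
        (w.transfer H hw).mapLe hHG = w := by
      intro w hw
      apply Walk.ext_support
      simp
    simpa only [h3] using h2
  unfold IsAcyclic at hcyc
  push Not at hcyc
  obtain ⟨v, c, hc⟩ := hcyc
  have h1 := girth_le_length (hc.mapLe hHG)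
  rw [Walk.length_map] at h1
  refine h1.trans ?_
  have h2 : c.edges.toFinset ⊆ (p.edges ++ q.edges).toFinset := by
    intro e he
    rw [List.mem_toFinset] at he ⊢
    exact hHE e (c.edges_subset_edgeSet he)
  have h3 := (Finset.card_le_card h2).trans (List.toFinset_card_le _)
  rw [List.toFinset_card_of_nodup hc.edges_nodup] at h3
  simpa using h3

/-- A shortest cycle is isometric: the distance of two of its vertices is the length of the shorter
of the two arcs between them. -/
theorem Walk.IsCycle.dist_getVert (hG : G.Connected) {a : V} {c : G.Walk a a} (hc : c.IsCycle)
    (hg : c.length = G.girth) {i j : ℕ} (hij : i ≤ j) (hj : j ≤ c.length) :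
    G.dist (c.getVert i) (c.getVert j) = min (j - i) (c.length - (j - i)) := by
  have h1 : G.dist (c.getVert i) (c.getVert j) ≤ j - i := by
    have h := dist_le ((c.drop i).take (j - i))
    rw [Walk.take_length, Walk.drop_getVert, Nat.add_sub_cancel' hij] at h
    omega
  have h2 : G.dist (c.getVert i) (c.getVert j) ≤ c.length - (j - i) := by
    have t := hG.dist_triangle (u := c.getVert i) (v := a) (w := c.getVert j)
    have t1 := dist_le (c.take i)
    have t2 := dist_le (c.drop j)
    rw [Walk.take_length] at t1
    rw [Walk.drop_length, G.dist_comm] at t2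
    rw [G.dist_comm] at t1
    omega
  refine le_antisymm (le_min h1 h2) ?_
  by_contra! hlt
  have hlen : j - i < c.length ∧ 0 < j - i := by
    rw [lt_min_iff] at hlt
    have := hc.three_le_length
    constructor
    · omega
    · omega
  obtain ⟨q, hqp, hq⟩ : ∃ q : G.Walk (c.getVert i) (c.getVert j), q.IsPath ∧ q.length = j - i := by
    rcases Nat.eq_zero_or_pos i with rfl | hi
    · refine ⟨(c.take j).copy c.getVert_zero.symm rfl, ?_, ?_⟩
      · rw [Walk.isPath_copy]; exact hc.isPath_take (by omega)
      · rw [Walk.length_copy, Walk.take_length]; omega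
    · refine ⟨((c.drop i).take (j - i)).copy rfl
        (by rw [Walk.drop_getVert, Nat.add_sub_cancel' hij]), ?_, ?_⟩
      · rw [Walk.isPath_copy]; exact (hc.isPath_drop hi).take _
      · rw [Walk.length_copy, Walk.take_length, Walk.drop_length]; omega
  obtain ⟨p, hp, hpl⟩ := hG.exists_path_of_dist (c.getVert i) (c.getVert j)
  have hne : p ≠ q := by
    rintro rfl
    rw [hq] at hpl
    rw [lt_min_iff] at hlt
    omega
  have := girth_le_length_add_length hp hqp hne
  rw [hq, hpl, ← hg] at this
  rw [lt_min_iff] at hlt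
  omega

end Girth

/-- `φ 0, …, φ (2k) = φ 0` are the successive vertices of an isometric cycle of length `2k ≥ 4`.
In a connected graph the condition on distances implies that the cycle closes up, that it has no
repeated vertices, and that successive vertices are adjacent. -/
structure IsIsometricEvenCycle {V : Type*} (G : SimpleGraph V) (k : ℕ) (φ : ℕ → V) : Prop where
  two_le : 2 ≤ k
  dist_eq : ∀ i j, i ≤ j → j ≤ 2 * k → G.dist (φ i) (φ j) = min (j - i) (2 * k - (j - i))

theorem exists_isIsometricEvenCycle {V : Type*} {G : SimpleGraph V} (hG : G.Connected)
    (hb : G.IsBipartite) (hcyc : ¬ G.IsAcyclic) : ∃ k φ, G.IsIsometricEvenCycle k φ := by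
  obtain ⟨a, c, hc, hg⟩ := exists_girth_eq_length.2 hcyc
  have heven : Even c.length := two_colorable_iff_forall_loop_even.1 hb a c
  obtain ⟨k, hk⟩ := heven
  have := hc.three_le_length
  refine ⟨k, c.getVert, by omega, fun i j hij hj => ?_⟩
  rw [hc.dist_getVert hG hg.symm hij (by omega), hk, two_mul]

/-! ### The lower bound -/

namespace IsIsometricEvenCycle

variable {V : Type*} {G : SimpleGraph V} {k : ℕ} {φ : ℕ → V}

theorem injOn (h : G.IsIsometricEvenCycle k φ) : Set.InjOn φ (Set.Iio (2 * k)) := by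
  intro i hi j hj hij
  simp only [Set.mem_Iio] at hi hj
  rcases le_total i j with hle | hle
  · have := h.dist_eq i j hle hj.le
    rw [hij, dist_self] at this
    omega
  · have := h.dist_eq j i hle hi.le
    rw [hij, dist_self] at this
    omega

theorem adj (h : G.IsIsometricEvenCycle k φ) {i : ℕ} (hi : i < 2 * k) :
    G.Adj (φ i) (φ (i + 1)) := by
  have := h.two_le
  rw [← dist_eq_one_iff_adj, h.dist_eq i (i + 1) (by omega) (by omega)]
  omega

theorem edge_inj (h : G.IsIsometricEvenCycle k φ) {i j : ℕ} (hi : i < 2 * k) (hj : j < 2 * k)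
    (he : s(φ i, φ (i + 1)) = s(φ j, φ (j + 1))) : i = j := by
  rcases Sym2.eq_iff.1 he with he | he
  · exact h.injOn hi hj he.1
  · have h2 := h.two_le
    rcases le_total i j with hle | hle
    · have h0 := h.dist_eq i (j + 1) (by omega) (by omega)
      rw [he.1, dist_self] at h0
      by_cases hij : i = j
      · exact hij
      · have h1 := h.dist_eq (i + 1) j (by omega) (by omega)
        rw [he.2, dist_self] at h1
        omega
    · have h0 := h.dist_eq j (i + 1) (by omega) (by omega)
      rw [he.2, dist_self] at h0
      by_cases hij : i = j
      · exact hij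
      · have h1 := h.dist_eq (j + 1) i (by omega) (by omega)
        rw [he.1, dist_self] at h1
        omega

variable [Fintype V]

/-- The edge `φ i, φ (i + 1)` of the cycle, oriented away from `z` (from `φ (i + 1)` to
`φ i` if both are equidistant from `z`, which does not occur in connected bipartite graphs). -/
noncomputable def awayDart (G : SimpleGraph V) (φ : ℕ → V) (z : V) (i : ℕ) : V × V :=
  if G.dist (φ i) z < G.dist (φ (i + 1)) z then (φ i, φ (i + 1)) else (φ (i + 1), φ i)

open scoped Classical in
/-- The edges of the cycle, given by their indices, that separate `z` from `y`. -/
noncomputable def cycleSeparating (G : SimpleGraph V) (k : ℕ) (φ : ℕ → V) (z y : V) : Finset ℕ :=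
  (Finset.range (2 * k)).filter fun i => awayDart G φ z i ∈ G.separatingDarts z y

open scoped Classical in
/-- If all vertices of the cycle are at distance at least `m` from `z`, its separating edges come in
addition to `m` others inside the ball of radius `m` around `z`. -/
theorem add_card_cycleSeparating_le (h : G.IsIsometricEvenCycle k φ) (hG : G.Connected) (z y : V)
    (m : ℕ) (hm : ∀ i ≤ 2 * k, m ≤ G.dist (φ i) z) (hy : m ≤ G.dist z y) :
    m + (cycleSeparating G k φ z y).card ≤ (G.separatingDarts z y).card := by
  have hinj : Set.InjOn (awayDart G φ z) (cycleSeparating G k φ z y) := by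
    intro i hi j hj hij
    simp only [cycleSeparating, Finset.coe_filter, Finset.mem_range, Set.mem_ofPred_eq] at hi hj
    apply h.edge_inj hi.1 hj.1
    have hs : ∀ i, s((awayDart G φ z i).1, (awayDart G φ z i).2) = s(φ i, φ (i + 1)) := by
      intro i
      unfold awayDart
      split_ifs
      · rfl
      · exact Sym2.eq_swap
    rw [← hs i, ← hs j, hij]
  rw [← Finset.card_image_of_injOn hinj]
  apply add_card_le_card_separatingDarts hG z y m hy
  · intro p hp
    obtain ⟨i, hi, rfl⟩ := Finset.mem_image.1 hp
    exact (Finset.mem_filter.1 hi).2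
  · intro p hp
    obtain ⟨i, hi, rfl⟩ := Finset.mem_image.1 hp
    have hi := Finset.mem_range.1 (Finset.mem_filter.1 hi).1
    unfold awayDart
    split_ifs
    · exact hm i (by omega)
    · exact hm (i + 1) (by omega)

/-- Of two antipodal vertices of the cycle, each edge of the cycle separates one from `z`. -/
theorem two_mul_le_card_add_card (h : G.IsIsometricEvenCycle k φ) (hG : G.Connected)
    (hb : G.IsBipartite) (z : V) {j : ℕ} (hj : j < k) :
    2 * k ≤ (cycleSeparating G k φ z (φ j)).card + (cycleSeparating G k φ z (φ (j + k))).card := by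
  classical
  refine le_trans ?_ (Finset.card_union_le _ _)
  conv_lhs => rw [← Finset.card_range (2 * k)]
  apply Finset.card_le_card
  intro i hi
  have hi' := Finset.mem_range.1 hi
  have hadj := h.adj hi'
  have hne := hb.dist_ne_of_adj hG hadj z
  have h2 := h.two_le
  -- distances within the cycle, for indices in either order
  have hd : ∀ a b, a ≤ 2 * k → b ≤ 2 * k →
      (a ≤ b ∧ G.dist (φ a) (φ b) = min (b - a) (2 * k - (b - a))) ∨
      (b ≤ a ∧ G.dist (φ a) (φ b) = min (a - b) (2 * k - (a - b))) := by
    intro a b ha hb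
    rcases le_total a b with hab | hab
    · exact Or.inl ⟨hab, h.dist_eq a b hab hb⟩
    · exact Or.inr ⟨hab, by rw [G.dist_comm, h.dist_eq b a hab ha]⟩
  have d1 := hd i j (by omega) (by omega)
  have d2 := hd (i + 1) j (by omega) (by omega)
  have d3 := hd i (j + k) (by omega) (by omega)
  have d4 := hd (i + 1) (j + k) (by omega) (by omega)
  simp only [Finset.mem_union, cycleSeparating, Finset.mem_filter, hi, true_and,
    mem_separatingDarts, awayDart]
  split_ifs with hlt
  · simp only [hadj, hlt, true_and]
    omega
  · have hlt' : G.dist (φ (i + 1)) z < G.dist (φ i) z := by omega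
    simp only [hadj.symm, hlt', true_and]
    omega

theorem le_excess_add_excess (h : G.IsIsometricEvenCycle k φ) (hG : G.Connected)
    (hb : G.IsBipartite) (z : V) {j : ℕ} (hj : j < k) :
    (k : ℤ) ≤ G.excess z (φ j) + G.excess z (φ (j + k)) := by
  obtain ⟨i₀, hi₀, hmin⟩ := Finset.exists_min_image (Finset.range (2 * k + 1))
    (fun i => G.dist (φ i) z) ⟨0, by simp⟩
  have hi₀' := Finset.mem_range.1 hi₀
  have hm : ∀ i ≤ 2 * k, G.dist (φ i₀) z ≤ G.dist (φ i) z := fun i hi =>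
    hmin i (Finset.mem_range.2 (by omega))
  have hcard := h.two_mul_le_card_add_card hG hb z hj
  have e1 := h.add_card_cycleSeparating_le hG z (φ j) _ hm
    (by rw [G.dist_comm (u := z)]; exact hm j (by omega))
  have e2 := h.add_card_cycleSeparating_le hG z (φ (j + k)) _ hm
    (by rw [G.dist_comm (u := z)]; exact hm (j + k) (by omega))
  -- `z` reaches both antipodes through its nearest vertex `φ i₀` on the cycle, and the distances of
  -- `φ i₀` from two antipodes add up to `k`
  have t1 := hG.dist_triangle (u := z) (v := φ i₀) (w := φ j)
  have t2 := hG.dist_triangle (u := z) (v := φ i₀) (w := φ (j + k))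
  have hsum : G.dist (φ i₀) (φ j) + G.dist (φ i₀) (φ (j + k)) = k := by
    rcases le_total i₀ j with a | a <;> rcases le_total i₀ (j + k) with b | b
    · rw [h.dist_eq i₀ j a (by omega), h.dist_eq i₀ (j + k) b (by omega)]; omega
    · omega
    · rw [G.dist_comm, h.dist_eq j i₀ a (by omega), h.dist_eq i₀ (j + k) b (by omega)]; omega
    · rw [G.dist_comm, h.dist_eq j i₀ a (by omega), G.dist_comm,
        h.dist_eq (j + k) i₀ b (by omega)]; omega
  rw [G.dist_comm (u := z) (v := φ i₀)] at t1 t2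
  unfold excess
  omega

open scoped Classical in
theorem sq_le_sum_excess (h : G.IsIsometricEvenCycle k φ) (hG : G.Connected)
    (hb : G.IsBipartite) (z : V) :
    (k : ℤ) ^ 2 ≤ ∑ y ∈ (Finset.range (2 * k)).image φ, G.excess z y := by
  rw [Finset.sum_image (fun i hi j hj hij =>
    h.injOn (by simpa using hi) (by simpa using hj) hij), two_mul, Finset.sum_range_add,
    ← Finset.sum_add_distrib]
  calc (k : ℤ) ^ 2 = ∑ _j ∈ Finset.range k, (k : ℤ) := by simp [sq]
    _ ≤ _ := Finset.sum_le_sum fun j hj => by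
      rw [add_comm k j]
      exact h.le_excess_add_excess hG hb z (Finset.mem_range.1 hj)

end IsIsometricEvenCycle

/-- If the sum of a symmetric nonnegative function over `C` in the second variable is always at
least `s`, then the pairs with second entry in `C` contribute at least `|V| s` to its total, and
those with only the first entry in `C` at least `(|V| - |C|) s`. -/
theorem sum_pairs_ge {V : Type*} [Fintype V] (f : V → V → ℤ) (hf : ∀ x y, f x y = f y x)
    (h0 : ∀ x y, 0 ≤ f x y) (C : Finset V) (s : ℤ) (hs : ∀ x, s ≤ ∑ y ∈ C, f x y) :
    (2 * Fintype.card V - C.card) * s ≤ ∑ p : V × V, f p.1 p.2 := by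
  classical
  have hC : ∀ D : Finset V, D.card * s ≤ ∑ x ∈ D, ∑ y ∈ C, f x y := by
    intro D
    rw [← nsmul_eq_mul, ← Finset.sum_const]
    exact Finset.sum_le_sum fun x _ => hs x
  have hcompl : ((Cᶜ : Finset V).card : ℤ) = Fintype.card V - C.card := by
    rw [Finset.card_compl, Nat.cast_sub (Finset.card_le_univ C)]
  rw [Fintype.sum_prod_type]
  have hsplit : ∀ x, ∑ y, f x y = ∑ y ∈ C, f x y + ∑ y ∈ Cᶜ, f x y := fun x =>
    (Finset.sum_add_sum_compl C _).symm
  simp only [hsplit]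
  rw [Finset.sum_add_distrib, ← Finset.sum_add_sum_compl C (fun x => ∑ y ∈ Cᶜ, f x y)]
  have h1 := hC Finset.univ
  have h2 : ((Cᶜ : Finset V).card : ℤ) * s ≤ ∑ x ∈ C, ∑ y ∈ Cᶜ, f x y := by
    rw [Finset.sum_comm]
    simpa only [hf] using hC Cᶜ
  have h3 : 0 ≤ ∑ x ∈ Cᶜ, ∑ y ∈ Cᶜ, f x y :=
    Finset.sum_nonneg fun x _ => Finset.sum_nonneg fun y _ => h0 x y
  rw [hcompl] at h2
  rw [Finset.card_univ] at h1
  linarith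

/-- Connected bipartite graphs that contain a cycle satisfy `Sz* - W ≥ 4n - 8`. -/
theorem four_mul_card_sub_eight_le {V : Type*} [Fintype V] {G : SimpleGraph V} (hG : G.Connected)
    (hb : G.IsBipartite) (hcyc : ¬ G.IsAcyclic) :
    4 * (Fintype.card V : ℝ) - 8 ≤ G.revisedSzegedIndex - G.wienerIndex := by
  classical
  obtain ⟨k, φ, h⟩ := exists_isIsometricEvenCycle hG hb hcyc
  set C := (Finset.range (2 * k)).image φ with hCdef
  have hCcard : C.card = 2 * k := by
    rw [hCdef, Finset.card_image_of_injOn, Finset.card_range]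
    exact fun i hi j hj hij => h.injOn (by simpa using hi) (by simpa using hj) hij
  have hsum := sum_pairs_ge G.excess G.excess_comm (excess_nonneg hG) C ((k : ℤ) ^ 2)
    (h.sq_le_sum_excess hG hb)
  have hle : 2 * k ≤ Fintype.card V := hCcard ▸ Finset.card_le_univ C
  have h2 := h.two_le
  rw [hCcard] at hsum
  have hfin : 8 * (Fintype.card V : ℤ) - 16 ≤ ∑ p : V × V, G.excess p.1 p.2 := by
    refine le_trans ?_ hsum
    zify at hle h2
    push_cast
    -- `2 (n - 2k) k² + 2 k³ ≥ 8 (n - 2k) + (16 k - 16)`, where `k³ - 8k + 8 = (k - 2)(k² + 2k - 4)`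
    have a1 : 0 ≤ ((Fintype.card V : ℤ) - 2 * k) * ((k : ℤ) ^ 2 - 4) :=
      mul_nonneg (by linarith) (by nlinarith)
    have a2 : 0 ≤ ((k : ℤ) - 2) * ((k : ℤ) ^ 2 + 2 * k - 4) :=
      mul_nonneg (by linarith) (by nlinarith)
    linarith
  have := two_mul_revisedSzegedIndex_sub_wienerIndex hb hG
  have hfin' : (8 * (Fintype.card V : ℝ) - 16) ≤ ((∑ p : V × V, G.excess p.1 p.2 : ℤ) : ℝ) := by
    exact_mod_cast hfin
  linarith

/-! ### Trees -/

section Tree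

variable {V : Type*} [Fintype V]

theorem exists_walk_notMem_edges_of_dist_lt {V : Type*} {T : SimpleGraph V} {u v x : V}
    (hT : T.Connected) (h : T.dist u x < T.dist v x) : ∃ p : T.Walk u x, s(u, v) ∉ p.edges := by
  classical
  obtain ⟨p, hp⟩ := hT.exists_walk_length_eq_dist u x
  refine ⟨p, fun he => ?_⟩
  have hv := p.snd_mem_support_of_mem_edges he
  have h1 := dist_le (p.dropUntil v hv)
  have h2 := p.length_dropUntil_le_length hv
  omega

/-- In a tree, the edges separating `x` from `y` are those on the path between them. -/
theorem excess_eq_zero_of_isTree {T : SimpleGraph V} (hT : T.IsTree) (x y : V) :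
    T.excess x y = 0 := by
  classical
  refine le_antisymm ?_ (excess_nonneg hT.connected x y)
  obtain ⟨p, hp⟩ := hT.connected.exists_walk_length_eq_dist x y
  have hmem : ∀ q ∈ T.separatingDarts x y, s(q.1, q.2) ∈ p.edges.toFinset := by
    rintro ⟨u, v⟩ hq
    obtain ⟨hadj, hx, hy⟩ := mem_separatingDarts.1 hq
    obtain ⟨a, ha⟩ := exists_walk_notMem_edges_of_dist_lt hT.connected hx
    obtain ⟨b, hb⟩ := exists_walk_notMem_edges_of_dist_lt hT.connected hy
    rw [Sym2.eq_swap] at hb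
    have hbr := isBridge_iff_forall_walk_mem_edges.1
      (isAcyclic_iff_forall_adj_isBridge.1 hT.isAcyclic hadj) ((a.append p).append b.reverse)
    simp only [Walk.edges_append, Walk.edges_reverse, List.mem_append, List.mem_reverse] at hbr
    simp only [List.mem_toFinset]
    tauto
  have hinj : Set.InjOn (fun q : V × V => s(q.1, q.2)) (T.separatingDarts x y) := by
    rintro ⟨u, v⟩ h1 ⟨u', v'⟩ h2 he
    rcases Sym2.eq_iff.1 he with he | he
    · exact Prod.ext he.1 he.2
    · obtain ⟨rfl, rfl⟩ : u = v' ∧ v = u' := he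
      have h1 := (mem_separatingDarts.1 h1).2.1
      have h2 := (mem_separatingDarts.1 h2).2.1
      simp only at h1 h2
      omega
  have h1 := Finset.card_le_card_of_injOn _ hmem hinj
  have h2 := List.toFinset_card_le p.edges
  rw [Walk.length_edges, hp] at h2
  unfold excess
  omega

end Tree

/-! ### Graphs glued at a vertex -/

section Glue

variable {α β : Type*} {A : SimpleGraph α} {B : SimpleGraph β} {a : α} {b : β}

/-- The retraction of `vertexGlue A a B b` onto `A`. -/
def glueFst (a : α) (b : β) : α ⊕ {y : β // y ≠ b} → α := Sum.elim id fun _ => a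

/-- The retraction of `vertexGlue A a B b` onto `B`. -/
def glueSnd (b : β) : α ⊕ {y : β // y ≠ b} → β := Sum.elim (fun _ => b) Subtype.val

open scoped Classical in
/-- The inclusion of the vertices of `B` in those of `vertexGlue A a B b`. -/
noncomputable def glueInr (a : α) (b : β) (y : β) : α ⊕ {y : β // y ≠ b} :=
  if h : y = b then .inl a else .inr ⟨y, h⟩

theorem glueInr_self : glueInr a b b = .inl a := by simp [glueInr]

theorem glueInr_val (y : {y : β // y ≠ b}) : glueInr a b y = .inr y := by simp [glueInr, y.2]

theorem glueFst_inl (x : α) : glueFst a b (.inl x) = x := rfl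

theorem glueSnd_inl (x : α) : glueSnd b (.inl x) = b := rfl

theorem glueFst_glueInr (y : β) : glueFst a b (glueInr a b y) = a := by
  unfold glueInr; split_ifs <;> rfl

theorem glueSnd_glueInr (y : β) : glueSnd b (glueInr a b y) = y := by
  unfold glueInr; split_ifs with h
  · exact h.symm
  · rfl

theorem glueInr_injective : Function.Injective (glueInr a b) :=
  Function.LeftInverse.injective glueSnd_glueInr

/-- Every edge of a glued graph comes from exactly one of its parts. -/
theorem vertexGlue_adj_iff {p q : α ⊕ {y : β // y ≠ b}} :
    (vertexGlue A a B b).Adj p q ↔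
      (∃ x y, A.Adj x y ∧ p = .inl x ∧ q = .inl y) ∨
      (∃ x y, B.Adj x y ∧ p = glueInr a b x ∧ q = glueInr a b y) := by
  constructor
  · rcases p with x | x <;> rcases q with y | y <;> intro h
    · exact Or.inl ⟨x, y, h, rfl, rfl⟩
    · obtain ⟨rfl, h⟩ := h
      exact Or.inr ⟨b, y, h, glueInr_self.symm, (glueInr_val y).symm⟩
    · obtain ⟨rfl, h⟩ := h
      exact Or.inr ⟨x, b, h, (glueInr_val x).symm, glueInr_self.symm⟩
    · exact Or.inr ⟨x, y, h, (glueInr_val x).symm, (glueInr_val y).symm⟩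
  · rintro (⟨x, y, h, rfl, rfl⟩ | ⟨x, y, h, rfl, rfl⟩)
    · exact h
    · by_cases hx : x = b <;> by_cases hy : y = b
      · exact absurd (hx.trans hy.symm) h.ne
      · subst hx; simp only [glueInr, hy, dif_pos, dif_neg, not_false_eq_true]; exact ⟨rfl, h⟩
      · subst hy; simp only [glueInr, hx, dif_pos, dif_neg, not_false_eq_true]; exact ⟨rfl, h⟩
      · simp only [glueInr, hx, hy, dif_neg, not_false_eq_true]; exact h

/-- The inclusion of `A` in `vertexGlue A a B b` as a graph homomorphism. -/
def glueHomInl (A : SimpleGraph α) (a : α) (B : SimpleGraph β) (b : β) :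
    A →g vertexGlue A a B b where
  toFun := .inl
  map_rel' h := vertexGlue_adj_iff.2 (Or.inl ⟨_, _, h, rfl, rfl⟩)

/-- The inclusion of `B` in `vertexGlue A a B b` as a graph homomorphism. -/
noncomputable def glueHomInr (A : SimpleGraph α) (a : α) (B : SimpleGraph β) (b : β) :
    B →g vertexGlue A a B b where
  toFun := glueInr a b
  map_rel' h := vertexGlue_adj_iff.2 (Or.inr ⟨_, _, h, rfl, rfl⟩)

/-- Two walks in the parts, between the respective retractions of two vertices, combine to a walk of
the added length in the glued graph. -/
theorem exists_walk_vertexGlue (p q : α ⊕ {y : β // y ≠ b})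
    (wA : A.Walk (glueFst a b p) (glueFst a b q)) (wB : B.Walk (glueSnd b p) (glueSnd b q)) :
    ∃ w : (vertexGlue A a B b).Walk p q, w.length ≤ wA.length + wB.length := by
  have iA : ∀ x y (w : A.Walk x y) p q, Sum.inl x = p → Sum.inl y = q →
      ∃ w' : (vertexGlue A a B b).Walk p q, w'.length = w.length := by
    rintro x y w _ _ rfl rfl
    exact ⟨w.map (glueHomInl A a B b), Walk.length_map _ _⟩
  have iB : ∀ x y (w : B.Walk x y) p q, glueInr a b x = p → glueInr a b y = q →
      ∃ w' : (vertexGlue A a B b).Walk p q, w'.length = w.length := by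
    rintro x y w _ _ rfl rfl
    exact ⟨w.map (glueHomInr A a B b), Walk.length_map _ _⟩
  rcases p with x | x <;> rcases q with y | y
  · obtain ⟨v, hv⟩ := iA _ _ wA (.inl x) (.inl y) rfl rfl
    exact ⟨v, hv.le.trans (Nat.le_add_right _ _)⟩
  · obtain ⟨v, hv⟩ := iA _ _ wA (.inl x) (.inl a) rfl rfl
    obtain ⟨v', hv'⟩ := iB _ _ wB (.inl a) (.inr y) glueInr_self (glueInr_val y)
    exact ⟨v.append v', by rw [Walk.length_append, hv, hv']⟩
  · obtain ⟨v, hv⟩ := iA _ _ wA (.inl a) (.inl y) rfl rfl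
    obtain ⟨v', hv'⟩ := iB _ _ wB (.inr x) (.inl a) (glueInr_val x) glueInr_self
    exact ⟨v'.append v, by rw [Walk.length_append, hv, hv', add_comm]⟩
  · obtain ⟨v, hv⟩ := iB _ _ wB (.inr x) (.inr y) (glueInr_val x) (glueInr_val y)
    exact ⟨v, hv.le.trans (Nat.le_add_left _ _)⟩

theorem vertexGlue_connected (hA : A.Connected) (hB : B.Connected) :
    (vertexGlue A a B b).Connected := by
  have : Nonempty (α ⊕ {y : β // y ≠ b}) := ⟨.inl a⟩
  refine ⟨fun p q => ?_⟩
  obtain ⟨wA⟩ := hA (glueFst a b p) (glueFst a b q)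
  obtain ⟨wB⟩ := hB (glueSnd b p) (glueSnd b q)
  exact ⟨(exists_walk_vertexGlue p q wA wB).choose⟩

theorem dist_add_dist_le_length (hA : A.Connected) (hB : B.Connected)
    {p q : α ⊕ {y : β // y ≠ b}} (w : (vertexGlue A a B b).Walk p q) :
    A.dist (glueFst a b p) (glueFst a b q) + B.dist (glueSnd b p) (glueSnd b q) ≤ w.length := by
  induction w with
  | nil => simp
  | @cons p r q h w ih =>
    have tA := hA.dist_triangle (u := glueFst a b p) (v := glueFst a b r) (w := glueFst a b q)
    have tB := hB.dist_triangle (u := glueSnd b p) (v := glueSnd b r) (w := glueSnd b q)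
    have hstep : A.dist (glueFst a b p) (glueFst a b r) + B.dist (glueSnd b p) (glueSnd b r) = 1 := by
      rcases vertexGlue_adj_iff.1 h with ⟨x, y, h', rfl, rfl⟩ | ⟨x, y, h', rfl, rfl⟩
      · simp [glueFst_inl, glueSnd_inl, h']
      · simp [glueFst_glueInr, glueSnd_glueInr, h']
    rw [Walk.length_cons]
    omega

theorem dist_vertexGlue (hA : A.Connected) (hB : B.Connected) (p q : α ⊕ {y : β // y ≠ b}) :
    (vertexGlue A a B b).dist p q =
      A.dist (glueFst a b p) (glueFst a b q) + B.dist (glueSnd b p) (glueSnd b q) := by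
  apply le_antisymm
  · obtain ⟨wA, hwA⟩ := hA.exists_walk_length_eq_dist (glueFst a b p) (glueFst a b q)
    obtain ⟨wB, hwB⟩ := hB.exists_walk_length_eq_dist (glueSnd b p) (glueSnd b q)
    obtain ⟨w, hw⟩ := exists_walk_vertexGlue p q wA wB
    rw [← hwA, ← hwB]
    exact (dist_le w).trans hw
  · obtain ⟨w, hw⟩ := (vertexGlue_connected (a := a) (b := b) hA hB).exists_walk_length_eq_dist p q
    rw [← hw]
    exact dist_add_dist_le_length hA hB w

/-- Adding the colours of the two retractions of a vertex modulo 2 gives a proper colouring. -/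
theorem vertexGlue_isBipartite (hA : A.IsBipartite) (hB : B.IsBipartite) :
    (vertexGlue A a B b).IsBipartite := by
  obtain ⟨cA⟩ := hA
  obtain ⟨cB⟩ := hB
  refine ⟨Coloring.mk (fun p => cA (glueFst a b p) + cB (glueSnd b p)) ?_⟩
  intro p q h
  rcases vertexGlue_adj_iff.1 h with ⟨x, y, h', rfl, rfl⟩ | ⟨x, y, h', rfl, rfl⟩
  · simpa [glueFst_inl, glueSnd_inl] using cA.valid h'
  · simpa [glueFst_glueInr, glueSnd_glueInr] using cB.valid h'

variable [Fintype α] [Fintype β] [Fintype (α ⊕ {y : β // y ≠ b})]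

theorem card_separatingDarts_vertexGlue (hA : A.Connected) (hB : B.Connected)
    (p q : α ⊕ {y : β // y ≠ b}) :
    ((vertexGlue A a B b).separatingDarts p q).card =
      (A.separatingDarts (glueFst a b p) (glueFst a b q)).card +
        (B.separatingDarts (glueSnd b p) (glueSnd b q)).card := by
  classical
  have hiA : Function.Injective (Prod.map Sum.inl Sum.inl :
      α × α → (α ⊕ {y : β // y ≠ b}) × (α ⊕ {y : β // y ≠ b})) :=
    Sum.inl_injective.prodMap Sum.inl_injective
  have hiB : Function.Injective (Prod.map (glueInr a b) (glueInr a b)) :=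
    glueInr_injective.prodMap glueInr_injective
  rw [← Finset.card_image_of_injective _ hiA, ← Finset.card_image_of_injective _ hiB,
    ← Finset.card_union_of_disjoint]
  · congr 1
    ext ⟨r, s⟩
    simp only [mem_separatingDarts, Finset.mem_union, Finset.mem_image, vertexGlue_adj_iff,
      dist_vertexGlue hA hB]
    constructor
    · rintro ⟨⟨x, y, h, rfl, rfl⟩ | ⟨x, y, h, rfl, rfl⟩, h1, h2⟩
      · refine Or.inl ⟨(x, y), ⟨h, ?_, ?_⟩, rfl⟩ <;>
        simp only [glueFst_inl, glueSnd_inl] at h1 h2 ⊢ <;> omega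
      · refine Or.inr ⟨(x, y), ⟨h, ?_, ?_⟩, rfl⟩ <;>
        simp only [glueFst_glueInr, glueSnd_glueInr] at h1 h2 ⊢ <;> omega
    · rintro (⟨⟨x, y⟩, ⟨h, h1, h2⟩, he⟩ | ⟨⟨x, y⟩, ⟨h, h1, h2⟩, he⟩)
      · obtain ⟨rfl, rfl⟩ := Prod.mk.inj he
        refine ⟨Or.inl ⟨x, y, h, rfl, rfl⟩, ?_, ?_⟩ <;>
        simp only [glueFst_inl, glueSnd_inl] at h1 h2 ⊢ <;> omega
      · obtain ⟨rfl, rfl⟩ := Prod.mk.inj he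
        refine ⟨Or.inr ⟨x, y, h, rfl, rfl⟩, ?_, ?_⟩ <;>
        simp only [glueFst_glueInr, glueSnd_glueInr] at h1 h2 ⊢ <;> omega
  · -- an edge of `B` inside the image of `A` would be a loop at `b`
    rw [Finset.disjoint_left]
    intro r h1 h2
    obtain ⟨⟨x, y⟩, -, rfl⟩ := Finset.mem_image.1 h1
    obtain ⟨⟨x', y'⟩, h, he⟩ := Finset.mem_image.1 h2
    obtain ⟨h3, h4⟩ := Prod.mk.inj he
    have h5 := congrArg (glueSnd b) h3
    have h6 := congrArg (glueSnd b) h4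
    simp only [glueSnd_glueInr, glueSnd_inl] at h5 h6
    exact (mem_separatingDarts.1 h).1.ne (h5.trans h6.symm)

theorem excess_vertexGlue (hA : A.Connected) (hB : B.Connected) (p q : α ⊕ {y : β // y ≠ b}) :
    (vertexGlue A a B b).excess p q =
      A.excess (glueFst a b p) (glueFst a b q) + B.excess (glueSnd b p) (glueSnd b q) := by
  unfold excess
  rw [card_separatingDarts_vertexGlue hA hB, dist_vertexGlue hA hB]
  push_cast
  ring

end Glue

/-! ### The 4-cycle, alone and with a tree attached -/

section FourCycle

theorem dist_cycleGraph_four (x y : Fin 4) :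
    (cycleGraph 4).dist x y = if x = y then 0 else if x - y = 2 then 2 else 1 := by
  have hG : (cycleGraph 4).Connected := cycleGraph_connected
  split_ifs with h h2
  · rw [h, dist_self]
  · have h1 : 1 < (cycleGraph 4).dist x y := by
      refine hG.one_lt_dist_of_ne_of_not_adj h ?_
      rw [cycleGraph_adj]
      revert x y; decide
    have a1 : (cycleGraph 4).Adj x (x + 1) := by rw [cycleGraph_adj]; clear h1; revert x y; decide
    have a2 : (cycleGraph 4).Adj (x + 1) y := by
      rw [cycleGraph_adj]; clear h1 a1; revert x y; decide
    have := dist_le (Walk.cons a1 (Walk.cons a2 Walk.nil))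
    simp only [Walk.length_cons, Walk.length_nil] at this
    omega
  · rw [dist_eq_one_iff_adj, cycleGraph_adj]
    revert x y; decide

theorem excess_cycleGraph_four (x y : Fin 4) :
    (cycleGraph 4).excess x y = if x = y then 0 else if x - y = 2 then 2 else 1 := by
  unfold excess separatingDarts
  simp only [dist_cycleGraph_four, cycleGraph_adj]
  rw [Finset.filter_congr_decidable]
  revert x y
  decide

end FourCycle

section FourCycleWithTree

variable {α : Type*} {T : SimpleGraph α}

theorem c4WithTree_connected (hT : T.IsTree) (w : α) : (T.c4WithTree w).Connected :=
  vertexGlue_connected hT.connected (cycleGraph_connected)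

theorem c4WithTree_isBipartite (hT : T.IsTree) (w : α) : (T.c4WithTree w).IsBipartite := by
  refine vertexGlue_isBipartite hT.isBipartite ?_
  refine ⟨Coloring.mk (fun x : Fin 4 => if x = 0 ∨ x = 2 then (0 : Fin 2) else 1) ?_⟩
  intro x y h
  rw [cycleGraph_adj] at h
  revert x y; decide

variable [Fintype α]

theorem sum_excess_c4WithTree (hT : T.IsTree) (w : α) :
    ∑ p : (α ⊕ {y : Fin 4 // y ≠ 0}) × (α ⊕ {y : Fin 4 // y ≠ 0}),
      (T.c4WithTree w).excess p.1 p.2 = 8 * Fintype.card α + 8 := by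
  have h : ∀ p q, (T.c4WithTree w).excess p q =
      (cycleGraph 4).excess (glueSnd 0 p) (glueSnd 0 q) := by
    intro p q
    rw [c4WithTree, excess_vertexGlue hT.connected (cycleGraph_connected),
      excess_eq_zero_of_isTree hT, zero_add]
  have c1 : ∑ y : {y : Fin 4 // y ≠ 0}, (cycleGraph 4).excess 0 y = 4 := by
    simp only [excess_cycleGraph_four]; decide
  have c2 : ∑ y : {y : Fin 4 // y ≠ 0}, (cycleGraph 4).excess y 0 = 4 := by
    simp only [excess_cycleGraph_four]; decide
  have c3 : ∑ x : {y : Fin 4 // y ≠ 0}, ∑ y : {y : Fin 4 // y ≠ 0},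
      (cycleGraph 4).excess x y = 8 := by
    simp only [excess_cycleGraph_four]; decide
  have c0 : (cycleGraph 4).excess 0 0 = 0 := by
    simp only [excess_cycleGraph_four]; decide
  rw [Fintype.sum_prod_type]
  simp only [h, Fintype.sum_sum_type, Finset.sum_add_distrib]
  simp only [glueSnd, Sum.elim_inl, Sum.elim_inr, c0, c1, c3, Finset.sum_const,
    smul_zero, zero_add]
  rw [← Finset.smul_sum, c2]
  simp only [Finset.card_univ, nsmul_eq_mul]
  ring

theorem revisedSzegedIndex_sub_wienerIndex_c4WithTree (hT : T.IsTree) (w : α) :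
    (T.c4WithTree w).revisedSzegedIndex - (T.c4WithTree w).wienerIndex
      = 4 * (Fintype.card α : ℝ) + 4 := by
  have := two_mul_revisedSzegedIndex_sub_wienerIndex (c4WithTree_isBipartite hT w)
    (c4WithTree_connected hT w)
  rw [sum_excess_c4WithTree hT w] at this
  push_cast at this
  linarith

/-- The excess of a tree vanishes, so the graph is not a tree and has at least as many edges as
vertices. -/
theorem card_le_ncard_edgeSet_c4WithTree (hT : T.IsTree) (w : α) :
    Fintype.card (α ⊕ {y : Fin 4 // y ≠ 0}) ≤ (T.c4WithTree w).edgeSet.ncard := by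
  have hG := c4WithTree_connected hT w
  have h1 := hG.card_vert_le_card_edgeSet_add_one
  by_contra! hlt
  have htree : (T.c4WithTree w).IsTree := by
    rw [isTree_iff_connected_and_card]
    refine ⟨hG, ?_⟩
    rw [Nat.card_coe_set_eq, Nat.card_eq_fintype_card] at h1 ⊢
    omega
  have h0 := sum_excess_c4WithTree hT w
  simp only [excess_eq_zero_of_isTree htree, Finset.sum_const_zero] at h0
  omega

end FourCycleWithTree

theorem not_isAcyclic_of_card_le {V : Type*} [Fintype V] {G : SimpleGraph V} (hG : G.Connected)
    (hm : Fintype.card V ≤ G.edgeSet.ncard) : ¬ G.IsAcyclic := by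
  intro hac
  have := (isTree_iff_connected_and_card.1 ⟨hG, hac⟩).2
  rw [Nat.card_coe_set_eq, Nat.card_eq_fintype_card] at this
  omega

end SimpleGraph

theorem corollary2p3 :
    -- the lower bound
    (∀ (V : Type*) [Fintype V] (G : SimpleGraph V),
      G.Connected → G.IsBipartite → 4 ≤ Fintype.card V → Fintype.card V ≤ G.edgeSet.ncard →
        4 * (Fintype.card V : ℝ) - 8 ≤ G.revisedSzegedIndex - G.wienerIndex) ∧
    -- sharpness for every `n ≥ 4`, attained by every 4-cycle with a tree on `n - 3` vertices
    (∀ n : ℕ, 4 ≤ n →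
      (∃ T : SimpleGraph (Fin (n - 3)), T.IsTree) ∧
      ∀ (α : Type*) [Fintype α] (T : SimpleGraph α) (w : α),
        T.IsTree → Fintype.card α = n - 3 →
          Fintype.card (α ⊕ {y : Fin 4 // y ≠ 0}) = n ∧
          (T.c4WithTree w).Connected ∧
          (T.c4WithTree w).IsBipartite ∧
          n ≤ (T.c4WithTree w).edgeSet.ncard ∧
          (T.c4WithTree w).revisedSzegedIndex - (T.c4WithTree w).wienerIndex
            = 4 * (n : ℝ) - 8) := by
  refine ⟨fun V _ G hG hb _ hm =>
    SimpleGraph.four_mul_card_sub_eight_le hG hb (SimpleGraph.not_isAcyclic_of_card_le hG hm),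
    fun n hn => ⟨?_, fun α _ T w hT hcard => ?_⟩⟩
  · have : Nonempty (Fin (n - 3)) := ⟨⟨0, by omega⟩⟩
    obtain ⟨T, -, hT⟩ := (SimpleGraph.connected_top (V := Fin (n - 3))).exists_isTree_le
    exact ⟨T, hT⟩
  · have hn' : Fintype.card (α ⊕ {y : Fin 4 // y ≠ 0}) = n := by
      simp only [Fintype.card_sum, hcard, Fintype.card_subtype_compl, Fintype.card_fin,
        Fintype.card_unique]
      omega
    refine ⟨hn', SimpleGraph.c4WithTree_connected hT w, SimpleGraph.c4WithTree_isBipartite hT w,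
      hn' ▸ SimpleGraph.card_le_ncard_edgeSet_c4WithTree hT w, ?_⟩
    rw [SimpleGraph.revisedSzegedIndex_sub_wienerIndex_c4WithTree hT w, hcard,
      Nat.cast_sub (by omega)]
    push_cast
    ring
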